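/- **Setting.** For a finite complex vector $x$ and $p\in[0,\infty]$ put $\|x\|_0=\#\{i:x_i\ne 0\}$, $\|x\|_p=\sum_i|x_i|^p$ if $0<p<1$, $\|x\|_p=(\sum_i|x_i|^p)^{1/p}$ if $1\le p<\infty$, and $\|x\|_\infty=\max_i|x_i|$. Let $p\in[0,\infty]$, $q\in[0,1]$. *Pattern of a vector.* For $N\in\mathbb N$ call a $0$–$1$ vector $Z$ feasible for $x$ if $\|Z\|_0\ge\min(N,\|x\|_0)$ and $\|x-x\circ Z\|_p\le(1-q)\|x\|_p$, where $\circ$ is the entrywise product. For $t\ge 0$ let $Z^{(t)}_i=0$ if $|x_i|\le t$ and $Z^{(t)}_i=1$ otherwise. The sparsity pattern $\mathcal Z(x)$ has $\mathcal Z(x)_i=0$ if and only if $Z^{(t)}_i=0$ for some $t\ge0$ with $Z^{(t)}$ feasible. (That is, entries are eliminated in ascending order of modulus as long as this is feasible, entries of equal modulus being eliminated together or all kept.) *Pattern of a matrix.* For $A\in\mathbb C^{m\times m}$, $\mathcal Z(A)\in\{0,1\}^{m\times m}$ is the entrywise OR of the patterns of the rows of $A$, computed with $N=N_{row}$, and of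 the columns of $A$, computed with $N=N_{col}$. Here either $N_{row}=\min(m,\dim\mathcal N(A)+1)$ and $N_{col}=\min(m,\dim\mathcal N(A^*)+1)$, or more generally $N_{row}=N_{col}$ is an arbitrary natural number. *Minimization problem.* Let $A=U\Sigma V^*$ be a singular value decomposition of $A\in\mathbb C^{m\times m}$ with singular values $\sigma_1\ge\sigma_2\ge\dots\ge 0$, let $u_i,v_i$ be the columns of $U,V$, let $r=\operatorname{rank}A$, and let $U_2,V_2$ consist of the last $m-r$ columns of $U,V$. Consider $$\min_X\ J(X;A)=\tfrac12\sum_{i=1}^r\frac1{\sigma_i^2}\|(X-A)v_i\|_2^2+\tfrac12\sum_{i=1}^r\frac1{\sigma_i^2}\|(X^*-A^*)u_i\|_2^2$$ over all $X\in\mathbb C^{m\times m}$ such that $XV_2=0$, $X^*U_2=0$, and $X_{ij}=0$ whenever $\mathcal Z(A)_{ij}=0$. *Special matrices.* Let $J_m$ have ones on the anti-diagonal and zeros elsewhere. For even $m$ let $K_m=\begin{bmatrix}0&I\\-I&0\end{bmatrix}$ with blocks of size $m/2$. Let $C_m^{\pm}$ have ones on the superdiagonal, $\pm1$ in the lower left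 corner (so $C_1^\pm=[\pm1]$), and zeros elsewhere. **Theorem.** This problem has exactly one minimizer $X$. If $A$ satisfies one of the following conditions, then $X$ satisfies the same condition: 1. Hermitian, $A-A^*=0$; skew-Hermitian, $A+A^*=0$; 2. complex-symmetric, $A-A^T=0$; skew-complex-symmetric, $A+A^T=0$; 3. ($m$ even) Hamiltonian, $K_mA+A^*K_m=0$; skew-Hamiltonian, $K_mA-A^*K_m=0$; 4. circulant, $AC_m^+-C_m^+A=0$; skew-circulant, $AC_m^--C_m^-A=0$; 5. centrosymmetric, $AJ_m-J_mA=0$; skew-centrosymmetric, $AJ_m+J_mA=0$; 6. persymmetric, $AJ_m-J_mA^*=0$; skew-persymmetric, $AJ_m+J_mA^*=0$. -/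

import Mathlib

open scoped ENNReal Matrix

namespace Sparsify

noncomputable section

/-! ### The sparsity pattern -/

/-- The `L_p` "norm" of a finite vector, for every `p ∈ [0, ∞]`: the number of non-zero entries for
`p = 0`, the sum `∑ |x_i| ^ p` without a root for `0 < p < 1`, the usual norm for `1 ≤ p ≤ ∞`. -/
def lpNorm {ι E : Type*} [Fintype ι] [NormedAddCommGroup E] (p : ℝ≥0∞) (x : ι → E) : ℝ :=
  if p = 0 then ({i | x i ≠ 0} : Set ι).ncard
  else if p = ∞ then ⨆ i, ‖x i‖
  else if p < 1 then ∑ i, ‖x i‖ ^ p.toReal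
  else (∑ i, ‖x i‖ ^ p.toReal) ^ (1 / p.toReal)

/-- Entrywise product of a complex vector with a real 0-1 vector. -/
def mask {ι : Type*} (x : ι → ℂ) (Z : ι → ℝ) : ι → ℂ := fun i => x i * (Z i : ℂ)

/-- The constraints on the pattern `Z` of a vector `x`: `Z` is a 0-1 vector, has at least `N` ones,
and the eliminated part of `x` is at most the fraction `1 - q` of `x` in the `L_p` norm. If `x` has
fewer than `N` non-zero entries, then `N` is replaced by the number of non-zero entries of `x`. -/
structure IsFeasiblePattern {ι : Type*} [Fintype ι] (p : ℝ≥0∞) (q : ℝ) (N : ℕ)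
    (x : ι → ℂ) (Z : ι → ℝ) : Prop where
  zero_or_one : ∀ i, Z i = 0 ∨ Z i = 1
  count : min (N : ℝ) (lpNorm 0 x) ≤ lpNorm 0 Z
  bound : lpNorm p (x - mask x Z) ≤ (1 - q) * lpNorm p x

open Classical in
/-- The pattern that eliminates exactly the entries of modulus at most `t`. -/
def levelPattern {ι : Type*} (x : ι → ℂ) (t : ℝ) : ι → ℝ :=
  fun i => if ‖x i‖ ≤ t then 0 else 1

open Classical in
/-- The computed sparsity pattern of a vector. Entries are eliminated in ascending order of modulus
for as long as the constraints hold, and entries of equal modulus are eliminated or kept together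
(so all of them are kept when they cannot all be eliminated). Equivalently, an entry is eliminated
if and only if some feasible level pattern eliminates it; see `vectorPattern_isFeasible` and
`vectorPattern_maximal`. -/
def vectorPattern {ι : Type*} [Fintype ι] (p : ℝ≥0∞) (q : ℝ) (N : ℕ) (x : ι → ℂ) : ι → ℝ :=
  fun i => if ∃ t : ℝ, 0 ≤ t ∧ IsFeasiblePattern p q N x (levelPattern x t) ∧ ‖x i‖ ≤ t
    then 0 else 1

theorem lpNorm_zero_vec {ι : Type*} [Fintype ι] (p : ℝ≥0∞) : lpNorm p (0 : ι → ℂ) = 0 := by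
  unfold lpNorm
  split_ifs with h0 h1 h2
  · simp
  · simp
  · simp [Real.zero_rpow (ENNReal.toReal_ne_zero.2 ⟨h0, h1⟩)]
  · have hp := ENNReal.toReal_ne_zero.2 ⟨h0, h1⟩
    simp [Real.zero_rpow hp, Real.zero_rpow (inv_ne_zero hp)]

theorem lpNorm_nonneg {ι : Type*} [Fintype ι] (p : ℝ≥0∞) (x : ι → ℂ) : 0 ≤ lpNorm p x := by
  unfold lpNorm
  split_ifs
  · positivity
  · exact Real.iSup_nonneg fun _ => norm_nonneg _
  · positivity
  · positivity

/-- Eliminating only the zero entries is always feasible. -/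
theorem levelPattern_zero_isFeasible {ι : Type*} [Fintype ι] (p : ℝ≥0∞) {q : ℝ} (hq : q ≤ 1)
    (N : ℕ) (x : ι → ℂ) : IsFeasiblePattern p q N x (levelPattern x 0) := by
  refine ⟨fun i => ?_, ?_, ?_⟩
  · unfold levelPattern
    split_ifs <;> simp
  · refine (min_le_right _ _).trans (le_of_eq ?_)
    simp [lpNorm, levelPattern]
  · have h : x - mask x (levelPattern x 0) = 0 := by
      funext i
      by_cases hi : x i = 0 <;> simp [mask, levelPattern, hi]
    rw [h, lpNorm_zero_vec]
    exact mul_nonneg (by linarith) (lpNorm_nonneg p x)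

/-- The computed pattern is itself a level pattern, and it is feasible. -/
theorem vectorPattern_isFeasible {ι : Type*} [Fintype ι] (p : ℝ≥0∞) {q : ℝ} (hq : q ≤ 1)
    (N : ℕ) (x : ι → ℂ) :
    IsFeasiblePattern p q N x (vectorPattern p q N x) ∧
      ∃ t : ℝ, 0 ≤ t ∧ vectorPattern p q N x = levelPattern x t := by
  classical
  suffices h : ∃ t : ℝ, 0 ≤ t ∧ IsFeasiblePattern p q N x (levelPattern x t) ∧
      vectorPattern p q N x = levelPattern x t by
    obtain ⟨t, ht, hf, he⟩ := h
    exact ⟨he ▸ hf, t, ht, he⟩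
  let E : ι → Prop := fun i =>
    ∃ t : ℝ, 0 ≤ t ∧ IsFeasiblePattern p q N x (levelPattern x t) ∧ ‖x i‖ ≤ t
  have key : ∀ t : ℝ, (∀ i, E i ↔ ‖x i‖ ≤ t) → vectorPattern p q N x = levelPattern x t := by
    intro t ht
    funext i
    simp only [vectorPattern, levelPattern]
    exact if_congr (ht i) rfl rfl
  have h0 := levelPattern_zero_isFeasible p hq N x
  by_cases hE : ∃ i, E i
  · obtain ⟨i₀, hi₀⟩ := hE
    obtain ⟨i, hi, hmax⟩ := Finset.exists_max_image (Finset.univ.filter E) (fun i => ‖x i‖)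
      ⟨i₀, by simpa using hi₀⟩
    obtain ⟨t, ht, hf, hle⟩ := (Finset.mem_filter.1 hi).2
    refine ⟨t, ht, hf, key t fun j => ⟨fun hj => ?_, fun hj => ⟨t, ht, hf, hj⟩⟩⟩
    exact (hmax j (by simpa using hj)).trans hle
  · push Not at hE
    exact ⟨0, le_rfl, h0, key 0 fun i =>
      ⟨fun hi => (hE i hi).elim, fun hi => ⟨0, le_rfl, h0, hi⟩⟩⟩

/-- Among the feasible level patterns, the computed pattern eliminates the largest number of
non-zero entries. -/
theorem vectorPattern_maximal {ι : Type*} [Fintype ι] (p : ℝ≥0∞) (q : ℝ) (N : ℕ) (x : ι → ℂ)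
    (t : ℝ) (ht : 0 ≤ t) (hf : IsFeasiblePattern p q N x (levelPattern x t)) :
    lpNorm 0 (x - mask x (levelPattern x t)) ≤
      lpNorm 0 (x - mask x (vectorPattern p q N x)) := by
  simp only [lpNorm, if_true, Nat.cast_le]
  refine Set.ncard_le_ncard (fun i hi => ?_) (Set.toFinite _)
  by_cases h : ‖x i‖ ≤ t
  · have hx : ∃ t : ℝ, 0 ≤ t ∧ IsFeasiblePattern p q N x (levelPattern x t) ∧ ‖x i‖ ≤ t :=
      ⟨t, ht, hf, h⟩
    simpa [mask, vectorPattern, hx, levelPattern, h] using hi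
  · simp [mask, levelPattern, h] at hi

/-- The sparsity pattern of a matrix: the union (entrywise OR) of the patterns of its rows, with at
least `Nrow` entries kept in each row, and the patterns of its columns, with at least `Ncol` entries
kept in each column. -/
def matrixPattern {m n : ℕ} (p : ℝ≥0∞) (q : ℝ) (Nrow Ncol : ℕ)
    (A : Matrix (Fin m) (Fin n) ℂ) : Matrix (Fin m) (Fin n) ℝ :=
  Matrix.of fun i j =>
    max (vectorPattern p q Nrow (fun k => A i k) j) (vectorPattern p q Ncol (fun k => A k j) i)

/-- The dimension of the null-space of `A`. -/
def nullity {m n : ℕ} (A : Matrix (Fin m) (Fin n) ℂ) : ℕ :=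
  Module.finrank ℂ (LinearMap.ker A.mulVecLin)

/-- The standard minimal number of entries kept in each row, `min (n, dim 𝒩(A) + 1)`. -/
def standardNrow {m n : ℕ} (A : Matrix (Fin m) (Fin n) ℂ) : ℕ := min n (nullity A + 1)

/-- The standard minimal number of entries kept in each column, `min (m, dim 𝒩(A*) + 1)`. -/
def standardNcol {m n : ℕ} (A : Matrix (Fin m) (Fin n) ℂ) : ℕ := min m (nullity Aᴴ + 1)

/-! ### The minimization problem -/

/-- A singular value decomposition `A = U Σ V*`. The `k`-th singular value is `σ k`, counted from
`k = 0`; the values `σ k` with `k ≥ min m n` play no role. -/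
structure SVD {m n : ℕ} (A : Matrix (Fin m) (Fin n) ℂ) where
  U : Matrix (Fin m) (Fin m) ℂ
  V : Matrix (Fin n) (Fin n) ℂ
  σ : ℕ → ℝ
  U_unitary : U ∈ Matrix.unitaryGroup (Fin m) ℂ
  V_unitary : V ∈ Matrix.unitaryGroup (Fin n) ℂ
  σ_nonneg : ∀ k, 0 ≤ σ k
  σ_antitone : Antitone σ
  eq_mul : A = U * (Matrix.of fun (i : Fin m) (j : Fin n) =>
    if (i : ℕ) = (j : ℕ) then (σ i : ℂ) else 0) * Vᴴ

namespace SVD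

variable {m n : ℕ} {A : Matrix (Fin m) (Fin n) ℂ}

/-- The last `m - rank A` columns of `U`. -/
def U₂ (D : SVD A) : Matrix (Fin m) {i : Fin m // A.rank ≤ (i : ℕ)} ℂ :=
  D.U.submatrix id Subtype.val

/-- The last `n - rank A` columns of `V`. -/
def V₂ (D : SVD A) : Matrix (Fin n) {j : Fin n // A.rank ≤ (j : ℕ)} ℂ :=
  D.V.submatrix id Subtype.val

/-- The misfit
`J(X; A) = ½ ∑_{i ≤ r} σ_i⁻² ‖(X - A) v_i‖² + ½ ∑_{i ≤ r} σ_i⁻² ‖(X* - A*) u_i‖²`,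
where `r = rank A`. -/
def misfit (D : SVD A) (X : Matrix (Fin m) (Fin n) ℂ) : ℝ :=
  1 / 2 * ∑ j ∈ Finset.univ.filter (fun j : Fin n => (j : ℕ) < A.rank),
      1 / D.σ j ^ 2 * ‖WithLp.toLp 2 ((X - A) *ᵥ D.V.col j)‖ ^ 2 +
  1 / 2 * ∑ i ∈ Finset.univ.filter (fun i : Fin m => (i : ℕ) < A.rank),
      1 / D.σ i ^ 2 * ‖WithLp.toLp 2 ((Xᴴ - Aᴴ) *ᵥ D.U.col i)‖ ^ 2

/-- The constraints: `X V₂ = 0`, `X* U₂ = 0`, and `X` vanishes where the pattern `Z` does. -/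
structure IsFeasible (D : SVD A) (Z : Matrix (Fin m) (Fin n) ℝ)
    (X : Matrix (Fin m) (Fin n) ℂ) : Prop where
  right_null : X * D.V₂ = 0
  left_null : Xᴴ * D.U₂ = 0
  pattern_zero : ∀ i j, Z i j = 0 → X i j = 0

/-- `X` minimizes the misfit among all matrices that satisfy the constraints. -/
structure IsMinimizer (D : SVD A) (Z : Matrix (Fin m) (Fin n) ℝ)
    (X : Matrix (Fin m) (Fin n) ℂ) : Prop where
  feasible : D.IsFeasible Z X
  le_misfit : ∀ Y, D.IsFeasible Z Y → D.misfit X ≤ D.misfit Y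

end SVD

/-! ### The matrix subspaces -/

/-- Ones on the anti-diagonal, zeros elsewhere. -/
def exchange (m : ℕ) : Matrix (Fin m) (Fin m) ℂ :=
  Matrix.of fun i j => if (i : ℕ) + j + 1 = m then 1 else 0

/-- `[0, I; -I, 0]` with blocks of size `m / 2`, for even `m`. -/
def skewK (m : ℕ) : Matrix (Fin m) (Fin m) ℂ :=
  Matrix.of fun i j =>
    if (j : ℕ) = i + m / 2 then 1 else if (i : ℕ) = j + m / 2 then -1 else 0

/-- `[0, I_{m-1}; ε, 0]`: ones on the superdiagonal, and `ε` in the lower left corner. -/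
def cyclic (m : ℕ) (ε : ℂ) : Matrix (Fin m) (Fin m) ℂ :=
  Matrix.of fun i j =>
    if (j : ℕ) = i + 1 then 1 else if (i : ℕ) + 1 = m ∧ (j : ℕ) = 0 then ε else 0

variable {m : ℕ}

def IsSkewHermitian (A : Matrix (Fin m) (Fin m) ℂ) : Prop := A + Aᴴ = 0

def IsComplexSymmetric (A : Matrix (Fin m) (Fin m) ℂ) : Prop := A - Aᵀ = 0

def IsSkewComplexSymmetric (A : Matrix (Fin m) (Fin m) ℂ) : Prop := A + Aᵀ = 0

def IsHamiltonian (A : Matrix (Fin m) (Fin m) ℂ) : Prop := skewK m * A + Aᴴ * skewK m = 0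

def IsSkewHamiltonian (A : Matrix (Fin m) (Fin m) ℂ) : Prop := skewK m * A - Aᴴ * skewK m = 0

def IsCirculant (A : Matrix (Fin m) (Fin m) ℂ) : Prop := A * cyclic m 1 - cyclic m 1 * A = 0

def IsSkewCirculant (A : Matrix (Fin m) (Fin m) ℂ) : Prop :=
  A * cyclic m (-1) - cyclic m (-1) * A = 0

def IsCentrosymmetric (A : Matrix (Fin m) (Fin m) ℂ) : Prop := A * exchange m - exchange m * A = 0

def IsSkewCentrosymmetric (A : Matrix (Fin m) (Fin m) ℂ) : Prop :=
  A * exchange m + exchange m * A = 0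

/-- Persymmetry with the conjugate transpose, `A J = J A*`. -/
def IsPersymmetric (A : Matrix (Fin m) (Fin m) ℂ) : Prop := A * exchange m - exchange m * Aᴴ = 0

def IsSkewPersymmetric (A : Matrix (Fin m) (Fin m) ℂ) : Prop :=
  A * exchange m + exchange m * Aᴴ = 0

end

end Sparsify

namespace Sparsify

/-! ### Patterns depend only on the moduli -/

/-! The feasible matrices form a linear subspace and the misfit is half a squared distance ‖L X - L
A‖², where L is linear. L is injective on that subspace: X V₂ = 0 together with X v_i = 0 for i ≤ r
forces X = 0. Orthogonal projection gives exactly one minimizer (`existsUnique_least_squares`).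

Each structure says that A is fixed by a map T of the form ε S X S*, ε S X* S* or ε Xᵀ, with ε = ±1
and S a unitary monomial matrix (identity, exchange, cyclic or K). By uniqueness it is enough that T
preserves feasibility and misfit (`fixed_of_preserves`). The pattern is respected because it depends
only on the moduli of the entries, which T permutes, possibly exchanging rows with columns.

Singular vectors are not unique, so they cannot be followed through T. The constraints and the
misfit are therefore rewritten in terms of A*A, AA* and their group inverses M and N: the null-space
constraints become X M A*A = X and N AA* X = X, and the misfit becomes a sum of two traces with
weights M and N. T carries the pair A*A, AA* to itself, in the same or the opposite order, and
uniqueness of group inverses transfers this to M, N. -/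

theorem lpNorm_congr {ι E F : Type*} [Fintype ι] [NormedAddCommGroup E] [NormedAddCommGroup F]
    (p : ℝ≥0∞) {x : ι → E} {y : ι → F} (π : Equiv.Perm ι) (h : ∀ i, ‖y i‖ = ‖x (π i)‖) :
    lpNorm p y = lpNorm p x := by
  have hs : ∀ f : ℝ → ℝ, ∑ i, f ‖y i‖ = ∑ i, f ‖x i‖ := fun f => by
    simp only [h]
    exact Equiv.sum_comp π fun i => f ‖x i‖
  have hc : ({i | y i ≠ 0} : Set ι).ncard = ({i | x i ≠ 0} : Set ι).ncard := by
    have : ({i | y i ≠ 0} : Set ι) = π ⁻¹' {i | x i ≠ 0} := by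
      ext i
      exact norm_ne_zero_iff.symm.trans ((h i).symm ▸ norm_ne_zero_iff)
    rw [this, Set.ncard_preimage_of_injective_subset_range π.injective (by simp)]
  have hm : (⨆ i, ‖y i‖) = ⨆ i, ‖x i‖ := by
    simp only [h]
    exact Equiv.iSup_comp (g := fun i => ‖x i‖) π
  unfold lpNorm
  rw [hc, hm, hs fun t => t ^ p.toReal]

theorem levelPattern_congr {ι : Type*} {x y : ι → ℂ} (π : Equiv.Perm ι)
    (h : ∀ i, ‖y i‖ = ‖x (π i)‖) (t : ℝ) (i : ι) :
    levelPattern y t i = levelPattern x t (π i) := by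
  simp only [levelPattern, h]

theorem isFeasiblePattern_congr {ι : Type*} [Fintype ι] (p : ℝ≥0∞) (q : ℝ) (N : ℕ)
    {x y : ι → ℂ} (π : Equiv.Perm ι) (h : ∀ i, ‖y i‖ = ‖x (π i)‖) (t : ℝ) :
    IsFeasiblePattern p q N y (levelPattern y t) ↔ IsFeasiblePattern p q N x (levelPattern x t) := by
  have hl := levelPattern_congr π h t
  have h01 : ∀ (z : ι → ℂ) i, levelPattern z t i = 0 ∨ levelPattern z t i = 1 := fun z i => by
    unfold levelPattern
    split_ifs <;> simp
  have hZ : lpNorm 0 (levelPattern y t) = lpNorm 0 (levelPattern x t) :=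
    lpNorm_congr 0 π fun i => by rw [hl]
  have hm : lpNorm p (y - mask y (levelPattern y t)) = lpNorm p (x - mask x (levelPattern x t)) :=
    lpNorm_congr p π fun i => by
      rcases h01 x (π i) with h0 | h0 <;> simp [mask, hl, h0, h]
  constructor <;> rintro ⟨-, hc, hb⟩
  · refine ⟨h01 x, ?_, ?_⟩
    · rwa [← hZ, ← lpNorm_congr 0 π h]
    · rwa [← hm, ← lpNorm_congr p π h]
  · refine ⟨h01 y, ?_, ?_⟩
    · rwa [hZ, lpNorm_congr 0 π h]
    · rwa [hm, lpNorm_congr p π h]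

theorem vectorPattern_congr {ι : Type*} [Fintype ι] (p : ℝ≥0∞) (q : ℝ) (N : ℕ)
    {x y : ι → ℂ} (π : Equiv.Perm ι) (h : ∀ i, ‖y i‖ = ‖x (π i)‖) (i : ι) :
    vectorPattern p q N y i = vectorPattern p q N x (π i) := by
  classical
  refine if_congr (exists_congr fun t => ?_) rfl rfl
  rw [isFeasiblePattern_congr p q N π h, h]

theorem matrixPattern_perm {m : ℕ} (p : ℝ≥0∞) (q : ℝ) (Nrow Ncol : ℕ)
    {A : Matrix (Fin m) (Fin m) ℂ} (π : Equiv.Perm (Fin m))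
    (h : ∀ i j, ‖A i j‖ = ‖A (π i) (π j)‖) (i j : Fin m) :
    matrixPattern p q Nrow Ncol A i j = matrixPattern p q Nrow Ncol A (π i) (π j) := by
  simp only [matrixPattern, Matrix.of_apply]
  rw [vectorPattern_congr p q Nrow (x := fun k => A (π i) k) π fun k => h i k,
    vectorPattern_congr p q Ncol (x := fun k => A k (π j)) π fun k => h k j]

/-- Row patterns on one side become column patterns on the other, which is why one common `N` is
required. -/
theorem matrixPattern_perm_swap {m : ℕ} (p : ℝ≥0∞) (q : ℝ) (N : ℕ)
    {A : Matrix (Fin m) (Fin m) ℂ} (π : Equiv.Perm (Fin m))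
    (h : ∀ i j, ‖A i j‖ = ‖A (π j) (π i)‖) (i j : Fin m) :
    matrixPattern p q N N A i j = matrixPattern p q N N A (π j) (π i) := by
  simp only [matrixPattern, Matrix.of_apply]
  rw [vectorPattern_congr p q N (x := fun k => A k (π i)) π fun k => h i k,
    vectorPattern_congr p q N (x := fun k => A (π j) k) π fun k => h k j, max_comm]

open scoped ComplexOrder in
-- This makes the two standard counts coincide for square matrices, so that symmetries exchanging
-- rows and columns apply to them.
theorem nullity_conjTranspose {m : ℕ} (A : Matrix (Fin m) (Fin m) ℂ) : nullity Aᴴ = nullity A := by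
  have h := A.mulVecLin.finrank_range_add_finrank_ker
  have h' := Aᴴ.mulVecLin.finrank_range_add_finrank_ker
  have hr : Aᴴ.rank = A.rank := Matrix.rank_conjTranspose A
  unfold Matrix.rank at hr
  unfold nullity
  omega

/-! ### Group inverses -/

/-- `b` is the group inverse of `a`. -/
structure IsGroupInverse {R : Type*} [Monoid R] (a b : R) : Prop where
  comm : a * b = b * a
  left : a * b * a = a
  right : b * a * b = b

theorem IsGroupInverse.unique {R : Type*} [Monoid R] {a b c : R} (hb : IsGroupInverse a b)
    (hc : IsGroupInverse a c) : b = c := by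
  -- The two idempotents agree; each group inverse is then recovered from its idempotent.
  have h : b * a = c * a := by
    calc b * a = b * (a * c * a) := by rw [hc.left]
      _ = (b * a) * (c * a) := by simp only [mul_assoc]
      _ = (a * b * a) * c := by rw [← hb.comm, ← hc.comm]; simp only [mul_assoc]
      _ = c * a := by rw [hb.left, hc.comm]
  calc b = b * a * b := hb.right.symm
    _ = c * (a * b) := by rw [h, mul_assoc]
    _ = c * (a * c) := by rw [hb.comm, h, hc.comm]
    _ = c := by rw [← mul_assoc, hc.right]

/-! ### Least squares over a subspace -/

/-- The residual of a best approximation is orthogonal to the image of `S`, so Pythagoras expresses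
every other residual through `L (z - x)`; injectivity on `S` turns equality of residuals into
equality of points. -/
theorem existsUnique_least_squares {W E : Type*} [AddCommGroup W] [Module ℂ W]
    [NormedAddCommGroup E] [InnerProductSpace ℂ E] [FiniteDimensional ℂ E]
    (L : W →ₗ[ℂ] E) (S : Submodule ℂ W) (hL : ∀ x ∈ S, L x = 0 → x = 0) (b : E) :
    ∃ x, ∀ y, (y ∈ S ∧ ∀ z ∈ S, ‖L y - b‖ ≤ ‖L z - b‖) ↔ y = x := by
  let K := S.map L
  obtain ⟨_, ⟨x, hx, rfl⟩, hv⟩ := K.exists_norm_eq_iInf_of_complete_subspace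
    (Submodule.complete_of_finiteDimensional K) b
  have ho := (K.norm_eq_iInf_iff_inner_eq_zero ⟨x, hx, rfl⟩).1 hv
  have hpy : ∀ z ∈ S, ‖L z - b‖ * ‖L z - b‖ = ‖L x - b‖ * ‖L x - b‖ + ‖L (z - x)‖ * ‖L (z - x)‖ := by
    intro z hz
    have h0 : inner ℂ (L x - b) (L (z - x)) = 0 := by
      rw [← neg_sub, inner_neg_left, ho _ ⟨z - x, S.sub_mem hz hx, rfl⟩, neg_zero]
    have := norm_add_sq_eq_norm_sq_add_norm_sq_of_inner_eq_zero _ _ h0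
    rwa [show L x - b + L (z - x) = L z - b by rw [map_sub]; abel] at this
  refine ⟨x, fun y => ⟨fun ⟨hy, hm⟩ => ?_, ?_⟩⟩
  · have h1 := hpy y hy
    have h2 := mul_self_le_mul_self (norm_nonneg _) (hm x hx)
    have h3 : ‖L (y - x)‖ = 0 := by nlinarith [norm_nonneg (L (y - x))]
    exact sub_eq_zero.1 (hL _ (S.sub_mem hy hx) (norm_eq_zero.1 h3))
  · rintro rfl
    refine ⟨hx, fun z hz => ?_⟩
    have h1 := hpy z hz
    exact abs_le_of_sq_le_sq' (by nlinarith [norm_nonneg (L (z - y))]) (norm_nonneg _) |>.2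

/-! ### The misfit and the constraints without the singular vectors -/

theorem diagonal_conj_mul {n : ℕ} {V : Matrix (Fin n) (Fin n) ℂ}
    (hV : V ∈ Matrix.unitaryGroup (Fin n) ℂ) (d e : Fin n → ℂ) :
    V * Matrix.diagonal d * Vᴴ * (V * Matrix.diagonal e * Vᴴ) =
      V * Matrix.diagonal (fun i => d i * e i) * Vᴴ := by
  have h : Vᴴ * V = 1 := Matrix.mem_unitaryGroup_iff'.1 hV
  rw [← Matrix.diagonal_mul_diagonal]
  simp only [Matrix.mul_assoc]
  rw [← Matrix.mul_assoc Vᴴ V, h, Matrix.one_mul]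

/-- Since 0⁻¹ = 0, the identity d d⁻¹ d = d also holds at zero entries, so no case split on the rank
is needed. -/
theorem isGroupInverse_diagonal_conj {n : ℕ} {V : Matrix (Fin n) (Fin n) ℂ}
    (hV : V ∈ Matrix.unitaryGroup (Fin n) ℂ) (d : Fin n → ℂ) :
    IsGroupInverse (V * Matrix.diagonal d * Vᴴ) (V * Matrix.diagonal (fun i => (d i)⁻¹) * Vᴴ) := by
  constructor
  · simp only [diagonal_conj_mul hV, mul_comm]
  · simp only [diagonal_conj_mul hV]
    congr! with i
    exact mul_inv_mul_cancel (d i)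
  · simp only [diagonal_conj_mul hV]
    congr 3
    funext i
    simpa using mul_inv_mul_cancel (d i)⁻¹

theorem trace_mul_conjTranspose_re {m n : ℕ} (Y : Matrix (Fin m) (Fin n) ℂ) :
    (Y * Yᴴ).trace.re = ∑ j, ∑ i, ‖Y i j‖ ^ 2 := by
  rw [Finset.sum_comm]
  simp only [Matrix.trace, Matrix.diag, Matrix.mul_apply, Matrix.conjTranspose_apply,
    Complex.re_sum]
  refine Finset.sum_congr rfl fun i _ => Finset.sum_congr rfl fun j _ => ?_
  rw [Complex.star_def, Complex.mul_conj, Complex.ofReal_re, Complex.normSq_eq_norm_sq]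

namespace SVD

variable {m : ℕ} {A : Matrix (Fin m) (Fin m) ℂ}

/-! ### The Gram matrices and their group inverses -/

theorem eq_diagonal (D : SVD A) :
    A = D.U * Matrix.diagonal (fun i : Fin m => (D.σ i : ℂ)) * D.Vᴴ := by
  convert D.eq_mul using 3
  ext i j
  simp only [Matrix.diagonal_apply, Matrix.of_apply, Fin.ext_iff]

theorem conjTranspose_eq_diagonal (D : SVD A) :
    Aᴴ = D.V * Matrix.diagonal (fun i : Fin m => (D.σ i : ℂ)) * D.Uᴴ := by
  conv_lhs => rw [D.eq_diagonal]
  simp only [Matrix.conjTranspose_mul, Matrix.diagonal_conjTranspose,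
    Matrix.conjTranspose_conjTranspose, Matrix.mul_assoc]
  congr! with i
  simp

/-- The rank counts the non-zero singular values, and by monotonicity these form an initial segment.
-/
theorem lt_rank_iff (D : SVD A) (j : Fin m) : (j : ℕ) < A.rank ↔ D.σ j ≠ 0 := by
  have hU : IsUnit D.U.det := Matrix.UnitaryGroup.det_isUnit ⟨D.U, D.U_unitary⟩
  have hV : IsUnit D.Vᴴ.det :=
    Matrix.UnitaryGroup.det_isUnit ⟨D.Vᴴ, Unitary.star_mem D.V_unitary⟩
  have hr : A.rank = (Finset.univ.filter fun i : Fin m => D.σ i ≠ 0).card := by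
    conv_lhs => rw [D.eq_diagonal]
    rw [Matrix.rank_mul_eq_left_of_isUnit_det _ _ hV, Matrix.rank_mul_eq_right_of_isUnit_det _ _ hU,
      Matrix.rank_diagonal, Fintype.card_subtype]
    simp
  rw [hr]
  constructor
  · intro h hj
    -- If `σ j` vanishes, every index with non-zero value lies below `j`, and there are only `j` of
    -- those.
    refine absurd (Finset.card_le_card (t := Finset.Iio j) fun i hi => ?_) (by simpa using h)
    rw [Finset.mem_Iio]
    by_contra hle
    exact (Finset.mem_filter.1 hi).2
      (le_antisymm (hj ▸ D.σ_antitone (Fin.le_def.1 (not_lt.1 hle))) (D.σ_nonneg i))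
  · intro hj
    have h := Finset.card_le_card (s := Finset.Iic j)
      (t := Finset.univ.filter fun i : Fin m => D.σ i ≠ 0) fun i hi => by
        rw [Finset.mem_filter]
        refine ⟨Finset.mem_univ _, fun h0 => hj (le_antisymm ?_ (D.σ_nonneg j))⟩
        exact h0 ▸ D.σ_antitone (Fin.le_def.1 (Finset.mem_Iic.1 hi))
    rw [Fin.card_Iic] at h
    omega

/-- The group inverse of `A* A`. -/
noncomputable def rightGram (D : SVD A) : Matrix (Fin m) (Fin m) ℂ :=
  D.V * Matrix.diagonal (fun i : Fin m => ((D.σ i : ℂ) * D.σ i)⁻¹) * D.Vᴴ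

/-- The group inverse of `A A*`. -/
noncomputable def leftGram (D : SVD A) : Matrix (Fin m) (Fin m) ℂ :=
  D.U * Matrix.diagonal (fun i : Fin m => ((D.σ i : ℂ) * D.σ i)⁻¹) * D.Uᴴ

theorem conjTranspose_mul_self (D : SVD A) :
    Aᴴ * A = D.V * Matrix.diagonal (fun i : Fin m => (D.σ i : ℂ) * D.σ i) * D.Vᴴ := by
  have h : D.Uᴴ * D.U = 1 := Matrix.mem_unitaryGroup_iff'.1 D.U_unitary
  conv_lhs => rw [D.conjTranspose_eq_diagonal]; arg 2; rw [D.eq_diagonal]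
  rw [← Matrix.diagonal_mul_diagonal]
  simp only [Matrix.mul_assoc]
  rw [← Matrix.mul_assoc D.Uᴴ, h, Matrix.one_mul]

theorem mul_conjTranspose_self (D : SVD A) :
    A * Aᴴ = D.U * Matrix.diagonal (fun i : Fin m => (D.σ i : ℂ) * D.σ i) * D.Uᴴ := by
  have h : D.Vᴴ * D.V = 1 := Matrix.mem_unitaryGroup_iff'.1 D.V_unitary
  conv_lhs => rw [D.conjTranspose_eq_diagonal]; arg 1; rw [D.eq_diagonal]
  rw [← Matrix.diagonal_mul_diagonal]
  simp only [Matrix.mul_assoc]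
  rw [← Matrix.mul_assoc D.Vᴴ, h, Matrix.one_mul]

theorem isGroupInverse_rightGram (D : SVD A) : IsGroupInverse (Aᴴ * A) D.rightGram := by
  rw [D.conjTranspose_mul_self]
  exact isGroupInverse_diagonal_conj D.V_unitary _

theorem isGroupInverse_leftGram (D : SVD A) : IsGroupInverse (A * Aᴴ) D.leftGram := by
  rw [D.mul_conjTranspose_self]
  exact isGroupInverse_diagonal_conj D.U_unitary _

/-- The diagonal is the 0-1 indicator of `s ≠ 0`, so its conjugate by `V` is the orthogonal
projector onto the span of the first `r` columns of `V`. -/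
theorem mul_unitary_diagonal_eq_iff {V X : Matrix (Fin m) (Fin m) ℂ}
    (hV : V ∈ Matrix.unitaryGroup (Fin m) ℂ) (s : ℕ → ℝ) (r : ℕ)
    (hs : ∀ j : Fin m, (j : ℕ) < r ↔ s j ≠ 0) :
    X * V.submatrix id (Subtype.val : {j : Fin m // r ≤ (j : ℕ)} → Fin m) = 0 ↔
      X * (V * Matrix.diagonal (fun i : Fin m => ((s i : ℂ) * s i)⁻¹ * ((s i : ℂ) * s i)) * Vᴴ)
        = X := by
  have h1 : Vᴴ * V = 1 := Matrix.mem_unitaryGroup_iff'.1 hV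
  have h2 : V * Vᴴ = 1 := Matrix.mem_unitaryGroup_iff.1 hV
  have hd : ∀ d, X * (V * Matrix.diagonal d * Vᴴ) = X ↔ X * V * Matrix.diagonal d = X * V := by
    intro d
    constructor <;> intro h
    · conv_rhs => rw [← h]
      simp only [Matrix.mul_assoc, h1, Matrix.mul_one]
    · rw [← Matrix.mul_assoc, ← Matrix.mul_assoc, h, Matrix.mul_assoc, h2, Matrix.mul_one]
  rw [hd]
  constructor
  · intro h
    ext i j
    rw [Matrix.mul_diagonal]
    by_cases hj : s j = 0
    · have := congrFun (congrFun h i) ⟨j, not_lt.1 fun hlt => (hs j).1 hlt hj⟩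
      have h0 : (X * V) i j = 0 := this
      rw [h0, zero_mul]
    · have : (s j : ℂ) ≠ 0 := Complex.ofReal_ne_zero.2 hj
      rw [inv_mul_cancel₀ (mul_ne_zero this this), mul_one]
  · intro h
    ext i ⟨j, hj⟩
    have := congrFun (congrFun h i) j
    have hj0 : s j = 0 := by
      by_contra hne
      exact absurd ((hs j).2 hne) (not_lt.2 hj)
    rw [Matrix.mul_diagonal, hj0] at this
    simp only [Complex.ofReal_zero, mul_zero] at this
    exact this.symm

theorem right_null_iff (D : SVD A) (X : Matrix (Fin m) (Fin m) ℂ) :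
    X * D.V₂ = 0 ↔ X * (D.rightGram * (Aᴴ * A)) = X := by
  rw [D.conjTranspose_mul_self, rightGram, diagonal_conj_mul D.V_unitary]
  exact mul_unitary_diagonal_eq_iff D.V_unitary D.σ A.rank D.lt_rank_iff

theorem left_null_iff (D : SVD A) (X : Matrix (Fin m) (Fin m) ℂ) :
    Xᴴ * D.U₂ = 0 ↔ D.leftGram * (A * Aᴴ) * X = X := by
  -- The projector is Hermitian, so taking adjoints reduces the left constraint to the right one.
  have h : (D.leftGram * (A * Aᴴ))ᴴ = D.leftGram * (A * Aᴴ) := by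
    rw [D.mul_conjTranspose_self, leftGram, diagonal_conj_mul D.U_unitary]
    simp only [Matrix.conjTranspose_mul, Matrix.diagonal_conjTranspose,
      Matrix.conjTranspose_conjTranspose, Matrix.mul_assoc]
    congr! with i
    simp
  rw [← Matrix.conjTranspose_inj (A := _ * X), Matrix.conjTranspose_mul, h,
    D.mul_conjTranspose_self, leftGram, diagonal_conj_mul D.U_unitary]
  exact mul_unitary_diagonal_eq_iff D.U_unitary D.σ A.rank D.lt_rank_iff

/-- The columns of `V`, scaled by the inverse singular values. -/
noncomputable def scaledV (D : SVD A) : Matrix (Fin m) (Fin m) ℂ :=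
  D.V * Matrix.diagonal (fun i : Fin m => ((D.σ i : ℂ))⁻¹)

/-- The columns of `U`, scaled by the inverse singular values. -/
noncomputable def scaledU (D : SVD A) : Matrix (Fin m) (Fin m) ℂ :=
  D.U * Matrix.diagonal (fun i : Fin m => ((D.σ i : ℂ))⁻¹)

theorem scaledV_mul_conjTranspose (D : SVD A) : D.scaledV * D.scaledVᴴ = D.rightGram := by
  rw [scaledV, rightGram, Matrix.conjTranspose_mul, Matrix.diagonal_conjTranspose,
    Matrix.mul_assoc, ← Matrix.mul_assoc (Matrix.diagonal _), Matrix.diagonal_mul_diagonal,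
    ← Matrix.mul_assoc]
  congr 3
  funext i
  simp

theorem scaledU_mul_conjTranspose (D : SVD A) : D.scaledU * D.scaledUᴴ = D.leftGram := by
  rw [scaledU, leftGram, Matrix.conjTranspose_mul, Matrix.diagonal_conjTranspose,
    Matrix.mul_assoc, ← Matrix.mul_assoc (Matrix.diagonal _), Matrix.diagonal_mul_diagonal,
    ← Matrix.mul_assoc]
  congr 3
  funext i
  simp

theorem sum_filter_weighted (V Y : Matrix (Fin m) (Fin m) ℂ) (s : ℕ → ℝ) (r : ℕ)
    (hs : ∀ j : Fin m, (j : ℕ) < r ↔ s j ≠ 0) :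
    ∑ j ∈ Finset.univ.filter (fun j : Fin m => (j : ℕ) < r),
      1 / s j ^ 2 * ‖WithLp.toLp 2 (Y *ᵥ V.col j)‖ ^ 2 =
    ∑ j, ∑ i, ‖(Y * (V * Matrix.diagonal (fun i : Fin m => ((s i : ℂ))⁻¹))) i j‖ ^ 2 := by
  rw [Finset.sum_filter]
  refine Finset.sum_congr rfl fun j _ => ?_
  have h : ∀ i, ‖(Y * (V * Matrix.diagonal (fun i : Fin m => ((s i : ℂ))⁻¹))) i j‖ ^ 2 =
      1 / s j ^ 2 * ‖(Y *ᵥ V.col j) i‖ ^ 2 := fun i => by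
    rw [← Matrix.mul_assoc, Matrix.mul_diagonal, norm_mul, mul_pow, norm_inv, Complex.norm_real,
      Real.norm_eq_abs, inv_pow, sq_abs, mul_comm, one_div]
    rfl
  simp only [h, EuclideanSpace.norm_sq_eq, ← Finset.mul_sum]
  split_ifs with hj
  · rfl
  -- Here 1 / 0 = 0: the weight itself discards the indices beyond the rank.
  · have h0 : s j = 0 := not_not.1 fun hne => hj ((hs j).2 hne)
    simp [h0]

theorem misfit_eq_sum (D : SVD A) (X : Matrix (Fin m) (Fin m) ℂ) :
    D.misfit X = 1 / 2 * ∑ j, ∑ i, ‖((X - A) * D.scaledV) i j‖ ^ 2 +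
      1 / 2 * ∑ j, ∑ i, ‖((X - A)ᴴ * D.scaledU) i j‖ ^ 2 := by
  rw [misfit, sum_filter_weighted D.V (X - A) D.σ A.rank D.lt_rank_iff,
    sum_filter_weighted D.U (Xᴴ - Aᴴ) D.σ A.rank D.lt_rank_iff, ← Matrix.conjTranspose_sub]
  rfl

/-- The singular vectors now enter only through the two group inverses; this is the form on which
symmetries act. -/
theorem misfit_eq_trace (D : SVD A) (X : Matrix (Fin m) (Fin m) ℂ) :
    D.misfit X = 1 / 2 * ((X - A) * D.rightGram * (X - A)ᴴ).trace.re +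
      1 / 2 * ((X - A)ᴴ * D.leftGram * (X - A)).trace.re := by
  rw [misfit_eq_sum, ← trace_mul_conjTranspose_re, ← trace_mul_conjTranspose_re,
    ← scaledV_mul_conjTranspose, ← scaledU_mul_conjTranspose]
  simp only [Matrix.conjTranspose_mul, Matrix.mul_assoc, Matrix.conjTranspose_conjTranspose]

/-! ### Existence and uniqueness of the minimizer -/

theorem isFeasible_iff (D : SVD A) (Z : Matrix (Fin m) (Fin m) ℝ) (X : Matrix (Fin m) (Fin m) ℂ) :
    D.IsFeasible Z X ↔ X * (D.rightGram * (Aᴴ * A)) = X ∧ D.leftGram * (A * Aᴴ) * X = X ∧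
      ∀ i j, Z i j = 0 → X i j = 0 := by
  rw [← right_null_iff, ← left_null_iff]
  exact ⟨fun h => ⟨h.1, h.2, h.3⟩, fun h => ⟨h.1, h.2.1, h.2.2⟩⟩

/-- The feasible matrices form a linear subspace. -/
def feasibleSubmodule (D : SVD A) (Z : Matrix (Fin m) (Fin m) ℝ) :
    Submodule ℂ (Matrix (Fin m) (Fin m) ℂ) where
  carrier := {X | D.IsFeasible Z X}
  add_mem' {X Y} hX hY := ⟨by rw [Matrix.add_mul, hX.1, hY.1, add_zero],
    by rw [Matrix.conjTranspose_add, Matrix.add_mul, hX.2, hY.2, add_zero],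
    fun i j h => by rw [Matrix.add_apply, hX.3 i j h, hY.3 i j h, add_zero]⟩
  zero_mem' := ⟨by simp, by simp, by simp⟩
  smul_mem' c X hX := ⟨by rw [Matrix.smul_mul, hX.1, smul_zero],
    by rw [Matrix.conjTranspose_smul, Matrix.smul_mul, hX.2, smul_zero],
    fun i j h => by rw [Matrix.smul_apply, hX.3 i j h, smul_zero]⟩

/-- The linear map whose residual is measured by the misfit. -/
noncomputable def residual (D : SVD A) : Matrix (Fin m) (Fin m) ℂ →ₗ[ℂ]
    EuclideanSpace ℂ ((Fin m × Fin m) ⊕ (Fin m × Fin m)) where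
  -- The second block uses `D.scaledUᴴ * Y` instead of its adjoint, which has the same moduli but
  -- would be conjugate-linear in `Y`.
  toFun Y := WithLp.toLp 2 (Sum.elim (fun k => (Y * D.scaledV) k.2 k.1)
    (fun k => (D.scaledUᴴ * Y) k.1 k.2))
  map_add' X Y := by
    ext (k | k) <;> simp [Matrix.add_mul, Matrix.mul_add]
  map_smul' c Y := by
    ext (k | k) <;> simp

theorem misfit_eq_norm (D : SVD A) (X : Matrix (Fin m) (Fin m) ℂ) :
    D.misfit X = 1 / 2 * ‖D.residual X - D.residual A‖ ^ 2 := by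
  rw [← map_sub, misfit_eq_sum, EuclideanSpace.norm_sq_eq, ← mul_add, Fintype.sum_sum_type,
    Fintype.sum_prod_type, Fintype.sum_prod_type]
  congr 4
  ext j
  refine Finset.sum_congr rfl fun i _ => ?_
  have : ((X - A)ᴴ * D.scaledU) i j = star ((D.scaledUᴴ * (X - A)) j i) := by
    rw [← Matrix.conjTranspose_apply, Matrix.conjTranspose_mul, Matrix.conjTranspose_conjTranspose]
  rw [this, norm_star]
  rfl

/-- The first half of the misfit suffices: X = X M A*A and M factors through `D.scaledV`. -/
theorem eq_zero_of_residual_eq_zero (D : SVD A) (Z : Matrix (Fin m) (Fin m) ℝ)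
    {X : Matrix (Fin m) (Fin m) ℂ} (hX : D.IsFeasible Z X) (h : D.residual X = 0) : X = 0 := by
  have h0 : X * D.scaledV = 0 := by
    ext i j
    exact congrArg (fun v => v.ofLp (Sum.inl (j, i))) h
  rw [← ((D.isFeasible_iff Z X).1 hX).1, ← scaledV_mul_conjTranspose, Matrix.mul_assoc,
    ← Matrix.mul_assoc X, h0, Matrix.zero_mul]

theorem existsUnique_isMinimizer (D : SVD A) (Z : Matrix (Fin m) (Fin m) ℝ) :
    ∃ X, ∀ Y, D.IsMinimizer Z Y ↔ Y = X := by
  obtain ⟨X, hX⟩ := existsUnique_least_squares D.residual (D.feasibleSubmodule Z)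
    (fun X hX h => D.eq_zero_of_residual_eq_zero Z hX h) (D.residual A)
  refine ⟨X, fun Y => Iff.trans ?_ (hX Y)⟩
  have hle : ∀ W, D.misfit Y ≤ D.misfit W ↔
      ‖D.residual Y - D.residual A‖ ≤ ‖D.residual W - D.residual A‖ := fun W => by
    rw [misfit_eq_norm, misfit_eq_norm, mul_le_mul_iff_right₀ (by norm_num),
      sq_le_sq₀ (norm_nonneg _) (norm_nonneg _)]
  exact ⟨fun h => ⟨h.1, fun W hW => (hle W).1 (h.2 W hW)⟩,
    fun h => ⟨h.1, fun W hW => (hle W).2 (h.2 W hW)⟩⟩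

end SVD

/-! ### Monomial unitary matrices -/

/-- Each row has a single non-zero entry, of modulus one, in the column given by `π`. -/
structure IsMonomial {m : ℕ} (S : Matrix (Fin m) (Fin m) ℂ) (π : Equiv.Perm (Fin m))
    (s : Fin m → ℂ) : Prop where
  norm_eq_one : ∀ i, ‖s i‖ = 1
  apply_eq : ∀ i j, S i j = if j = π i then s i else 0

namespace IsMonomial

variable {m : ℕ} {S : Matrix (Fin m) (Fin m) ℂ} {π : Equiv.Perm (Fin m)} {s : Fin m → ℂ}

theorem mul_apply (h : IsMonomial S π s) (X : Matrix (Fin m) (Fin m) ℂ) (i j : Fin m) :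
    (S * X) i j = s i * X (π i) j := by
  simp [Matrix.mul_apply, h.apply_eq]

theorem mul_conjTranspose_apply (h : IsMonomial S π s) (X : Matrix (Fin m) (Fin m) ℂ)
    (i j : Fin m) : (X * Sᴴ) i j = X i (π j) * star (s j) := by
  simp [Matrix.mul_apply, h.apply_eq, apply_ite]

theorem conj_apply (h : IsMonomial S π s) (X : Matrix (Fin m) (Fin m) ℂ) (i j : Fin m) :
    (S * X * Sᴴ) i j = s i * X (π i) (π j) * star (s j) := by
  rw [h.mul_conjTranspose_apply, h.mul_apply]

theorem norm_conj_apply (h : IsMonomial S π s) (X : Matrix (Fin m) (Fin m) ℂ) (i j : Fin m) :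
    ‖(S * X * Sᴴ) i j‖ = ‖X (π i) (π j)‖ := by
  rw [h.conj_apply, norm_mul, norm_mul, norm_star, h.norm_eq_one, h.norm_eq_one, one_mul, mul_one]

theorem mul_conjTranspose (h : IsMonomial S π s) : S * Sᴴ = 1 := by
  ext i j
  rw [h.mul_conjTranspose_apply, h.apply_eq, Matrix.one_apply]
  by_cases hij : i = j
  · subst hij
    simp [Complex.mul_conj, Complex.normSq_eq_norm_sq, h.norm_eq_one]
  · simp [hij, Ne.symm hij]

theorem conjTranspose_mul (h : IsMonomial S π s) : Sᴴ * S = 1 :=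
  mul_eq_one_comm.1 h.mul_conjTranspose

end IsMonomial

theorem isMonomial_one (m : ℕ) : IsMonomial (1 : Matrix (Fin m) (Fin m) ℂ) 1 1 :=
  ⟨fun _ => by simp, fun i j => by simp [Matrix.one_apply, eq_comm]⟩

theorem isMonomial_exchange (m : ℕ) : IsMonomial (exchange m) Fin.revPerm 1 := by
  refine ⟨fun _ => by simp, fun i j => ?_⟩
  simp only [exchange, Matrix.of_apply, Fin.revPerm_apply, Fin.ext_iff, Fin.val_rev, Pi.one_apply]
  congr 1
  rw [eq_iff_iff]
  omega

theorem exists_isMonomial_cyclic (m : ℕ) {ε : ℂ} (hε : ‖ε‖ = 1) :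
    ∃ π s, IsMonomial (cyclic m ε) π s := by
  -- The successor modulo `m`; only the last row wraps around, and it carries `ε`.
  let f : Fin m → Fin m := fun i =>
    if h : (i : ℕ) + 1 < m then ⟨i + 1, h⟩ else ⟨0, i.pos⟩
  have hf : ∀ i, (f i : ℕ) = if (i : ℕ) + 1 < m then (i : ℕ) + 1 else 0 := fun i => by
    simp only [f]
    split_ifs <;> rfl
  have hinj : Function.Injective f := fun i j hij => by
    have := congrArg Fin.val hij
    rw [hf, hf] at this
    ext
    split_ifs at this <;> omega
  refine ⟨Equiv.ofBijective f (Finite.injective_iff_bijective.1 hinj),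
    fun i => if (i : ℕ) + 1 < m then 1 else ε, fun i => ?_, fun i j => ?_⟩
  · split_ifs <;> simp [hε]
  · simp only [cyclic, Matrix.of_apply, Equiv.ofBijective_apply, Fin.ext_iff, hf]
    split_ifs <;> first | rfl | omega

theorem exists_isMonomial_skewK {m : ℕ} (hm : Even m) : ∃ π s, IsMonomial (skewK m) π s := by
  obtain ⟨k, rfl⟩ := hm
  -- Exchange of the two halves of the index set.
  let f : Fin (k + k) → Fin (k + k) := fun i =>
    if h : (i : ℕ) < k then ⟨i + k, by omega⟩ else ⟨i - k, by omega⟩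
  have hf : ∀ i, (f i : ℕ) = if (i : ℕ) < k then (i : ℕ) + k else i - k := fun i => by
    simp only [f]
    split_ifs <;> rfl
  have hinj : Function.Injective f := fun i j hij => by
    have := congrArg Fin.val hij
    rw [hf, hf] at this
    ext
    split_ifs at this <;> omega
  refine ⟨Equiv.ofBijective f (Finite.injective_iff_bijective.1 hinj),
    fun i => if (i : ℕ) < k then 1 else -1, fun i => ?_, fun i j => ?_⟩
  · split_ifs <;> simp
  · have hk : (k + k) / 2 = k := by omega
    simp only [skewK, Matrix.of_apply, Equiv.ofBijective_apply, Fin.ext_iff, hf, hk]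
    split_ifs <;> first | rfl | omega

/-! ### Symmetries of the minimization problem -/

/-- Conjugation by a unitary matrix. -/
def conjBy {m : ℕ} (S X : Matrix (Fin m) (Fin m) ℂ) : Matrix (Fin m) (Fin m) ℂ := S * X * Sᴴ

section conjBy

variable {m : ℕ} {S : Matrix (Fin m) (Fin m) ℂ}

theorem conjBy_mul (hS : Sᴴ * S = 1) (X Y : Matrix (Fin m) (Fin m) ℂ) :
    conjBy S (X * Y) = conjBy S X * conjBy S Y := by
  simp only [conjBy, Matrix.mul_assoc]
  rw [← Matrix.mul_assoc Sᴴ S, hS, Matrix.one_mul]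

theorem conjBy_conjTranspose (X : Matrix (Fin m) (Fin m) ℂ) :
    (conjBy S X)ᴴ = conjBy S Xᴴ := by
  simp only [conjBy, Matrix.conjTranspose_mul, Matrix.conjTranspose_conjTranspose,
    Matrix.mul_assoc]

theorem trace_conjBy (hS : Sᴴ * S = 1) (X : Matrix (Fin m) (Fin m) ℂ) :
    (conjBy S X).trace = X.trace := by
  rw [conjBy, Matrix.trace_mul_comm, ← Matrix.mul_assoc, hS, Matrix.one_mul]

theorem conjBy_sub (X Y : Matrix (Fin m) (Fin m) ℂ) :
    conjBy S (X - Y) = conjBy S X - conjBy S Y := by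
  simp only [conjBy, Matrix.mul_sub, Matrix.sub_mul]

theorem IsGroupInverse.conjBy (hS : Sᴴ * S = 1) {G M : Matrix (Fin m) (Fin m) ℂ}
    (h : IsGroupInverse G M) : IsGroupInverse (conjBy S G) (conjBy S M) :=
  ⟨by simp only [← conjBy_mul hS, h.comm], by simp only [← conjBy_mul hS, h.left],
    by simp only [← conjBy_mul hS, h.right]⟩

/-- Transposition reverses products, and the three defining identities are invariant under reversal.
-/
theorem IsGroupInverse.transpose {G M : Matrix (Fin m) (Fin m) ℂ}
    (h : IsGroupInverse G M) : IsGroupInverse Gᵀ Mᵀ :=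
  ⟨by simp only [← Matrix.transpose_mul, h.comm],
    by simp only [← Matrix.transpose_mul, ← Matrix.mul_assoc, h.left],
    by simp only [← Matrix.transpose_mul, ← Matrix.mul_assoc, h.right]⟩

end conjBy

theorem norm_eq_one_of_mul_self {ε : ℝ} (hε : ε * ε = 1) : ‖ε‖ = 1 := by
  rcases mul_self_eq_one_iff.1 hε with rfl | rfl <;> simp

theorem norm_smul_conjBy_apply {m : ℕ} {S : Matrix (Fin m) (Fin m) ℂ} {π : Equiv.Perm (Fin m)}
    {s : Fin m → ℂ} (hS : IsMonomial S π s) {ε : ℝ} (hε : ε * ε = 1)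
    (X : Matrix (Fin m) (Fin m) ℂ) (i j : Fin m) :
    ‖(ε • conjBy S X) i j‖ = ‖X (π i) (π j)‖ := by
  rw [Matrix.smul_apply, norm_smul, norm_eq_one_of_mul_self hε, one_mul]
  exact hS.norm_conj_apply X i j

namespace SVD

variable {m : ℕ} {A : Matrix (Fin m) (Fin m) ℂ}

/-- A map that fixes the minimization problem fixes its minimizer. -/
theorem fixed_of_preserves (D : SVD A) {Z : Matrix (Fin m) (Fin m) ℝ}
    {X : Matrix (Fin m) (Fin m) ℂ} (hX : ∀ Y, D.IsMinimizer Z Y ↔ Y = X)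
    (T : Matrix (Fin m) (Fin m) ℂ → Matrix (Fin m) (Fin m) ℂ)
    (hT : D.IsFeasible Z X → D.IsFeasible Z (T X)) (hJ : D.misfit (T X) = D.misfit X) :
    T X = X := by
  have h := (hX X).2 rfl
  exact (hX _).1 ⟨hT h.1, fun Y hY => hJ.trans_le (h.2 Y hY)⟩

/-- Two commuting Hermitian factors. This lets an adjoint turn the left constraint on `X` into a
right constraint on `Xᴴ`. -/
theorem leftGram_mul_conjTranspose (D : SVD A) :
    (D.leftGram * (A * Aᴴ))ᴴ = D.leftGram * (A * Aᴴ) := by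
  rw [← scaledU_mul_conjTranspose, Matrix.conjTranspose_mul, Matrix.conjTranspose_mul,
    Matrix.conjTranspose_mul, Matrix.conjTranspose_conjTranspose,
    Matrix.conjTranspose_conjTranspose, scaledU_mul_conjTranspose]
  exact D.isGroupInverse_leftGram.comm

theorem rightGram_mul_conjTranspose (D : SVD A) :
    (D.rightGram * (Aᴴ * A))ᴴ = D.rightGram * (Aᴴ * A) := by
  rw [← scaledV_mul_conjTranspose, Matrix.conjTranspose_mul, Matrix.conjTranspose_mul,
    Matrix.conjTranspose_mul, Matrix.conjTranspose_conjTranspose,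
    Matrix.conjTranspose_conjTranspose, scaledV_mul_conjTranspose]
  exact D.isGroupInverse_rightGram.comm

variable {S : Matrix (Fin m) (Fin m) ℂ} {π : Equiv.Perm (Fin m)} {s : Fin m → ℂ}
  {X : Matrix (Fin m) (Fin m) ℂ}

/-- Both Gram matrices are fixed, since ε² = 1 drops out of quadratic expressions. Rows go to rows,
so the two counts may differ. -/
theorem minimizer_conj (D : SVD A) (hS : IsMonomial S π s) (p : ℝ≥0∞) (q : ℝ) (Nrow Ncol : ℕ)
    (hX : ∀ Y, D.IsMinimizer (matrixPattern p q Nrow Ncol A) Y ↔ Y = X) {ε : ℝ}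
    (hε : ε * ε = 1) (hA : ε • conjBy S A = A) : ε • conjBy S X = X := by
  have hs := hS.conjTranspose_mul
  have hG : Aᴴ * A = conjBy S (Aᴴ * A) := by
    conv_lhs => rw [← hA]
    rw [Matrix.conjTranspose_smul, conjBy_conjTranspose, Matrix.smul_mul, Matrix.mul_smul,
      smul_smul, star_trivial, hε, one_smul, conjBy_mul hs]
  have hH : A * Aᴴ = conjBy S (A * Aᴴ) := by
    conv_lhs => rw [← hA]
    rw [Matrix.conjTranspose_smul, conjBy_conjTranspose, Matrix.smul_mul, Matrix.mul_smul,
      smul_smul, star_trivial, hε, one_smul, conjBy_mul hs]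
  have hM : D.rightGram = conjBy S D.rightGram :=
    D.isGroupInverse_rightGram.unique (hG ▸ D.isGroupInverse_rightGram.conjBy hs)
  have hN : D.leftGram = conjBy S D.leftGram :=
    D.isGroupInverse_leftGram.unique (hH ▸ D.isGroupInverse_leftGram.conjBy hs)
  refine D.fixed_of_preserves hX (fun X => ε • conjBy S X) (fun h => ?_) ?_
  · rw [isFeasible_iff] at h ⊢
    obtain ⟨h1, h2, h3⟩ := h
    refine ⟨?_, ?_, fun i j hij => ?_⟩
    · rw [Matrix.smul_mul]
      conv_rhs => rw [← h1]
      rw [conjBy_mul hs, conjBy_mul hs, ← hM, ← hG]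
    · rw [Matrix.mul_smul]
      conv_rhs => rw [← h2]
      rw [conjBy_mul hs, conjBy_mul hs, ← hN, ← hH]
    · rw [matrixPattern_perm p q Nrow Ncol π fun i j => ?_] at hij
      · rw [Matrix.smul_apply, conjBy, hS.conj_apply, h3 _ _ hij, mul_zero, zero_mul, smul_zero]
      · conv_lhs => rw [← hA]
        exact norm_smul_conjBy_apply hS hε A i j
  · have hd : ε • conjBy S X - A = ε • conjBy S (X - A) := by
      rw [conjBy_sub, smul_sub, hA]
    rw [misfit_eq_trace, misfit_eq_trace, hd, Matrix.conjTranspose_smul, conjBy_conjTranspose]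
    simp only [Matrix.smul_mul, Matrix.mul_smul, smul_smul, star_trivial, hε, one_smul]
    rw [hM, hN]
    simp only [← conjBy_mul hs, trace_conjBy hs]
    rw [← hM, ← hN]

/-- The adjoint exchanges the two Gram matrices, and with them the two null-space constraints and
the two halves of the misfit. -/
theorem minimizer_conj_conjTranspose (D : SVD A) (hS : IsMonomial S π s) (p : ℝ≥0∞) (q : ℝ) (N : ℕ)
    (hX : ∀ Y, D.IsMinimizer (matrixPattern p q N N A) Y ↔ Y = X) {ε : ℝ}
    (hε : ε * ε = 1) (hA : ε • conjBy S Aᴴ = A) : ε • conjBy S Xᴴ = X := by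
  have hs := hS.conjTranspose_mul
  have hG : Aᴴ * A = conjBy S (A * Aᴴ) := by
    conv_lhs => rw [← hA]
    rw [Matrix.conjTranspose_smul, conjBy_conjTranspose, Matrix.smul_mul, Matrix.mul_smul,
      smul_smul, star_trivial, hε, one_smul, conjBy_mul hs, Matrix.conjTranspose_conjTranspose]
  have hH : A * Aᴴ = conjBy S (Aᴴ * A) := by
    conv_lhs => rw [← hA]
    rw [Matrix.conjTranspose_smul, conjBy_conjTranspose, Matrix.smul_mul, Matrix.mul_smul,
      smul_smul, star_trivial, hε, one_smul, conjBy_mul hs, Matrix.conjTranspose_conjTranspose]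
  have hM : D.rightGram = conjBy S D.leftGram :=
    D.isGroupInverse_rightGram.unique (hG ▸ D.isGroupInverse_leftGram.conjBy hs)
  have hN : D.leftGram = conjBy S D.rightGram :=
    D.isGroupInverse_leftGram.unique (hH ▸ D.isGroupInverse_rightGram.conjBy hs)
  refine D.fixed_of_preserves hX (fun X => ε • conjBy S Xᴴ) (fun h => ?_) ?_
  · rw [isFeasible_iff] at h ⊢
    obtain ⟨h1, h2, h3⟩ := h
    refine ⟨?_, ?_, fun i j hij => ?_⟩
    · rw [Matrix.smul_mul]
      conv_rhs => rw [← h2]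
      rw [Matrix.conjTranspose_mul, leftGram_mul_conjTranspose, conjBy_mul hs, conjBy_mul hs,
        ← hM, ← hG]
    · rw [Matrix.mul_smul]
      conv_rhs => rw [← h1]
      rw [Matrix.conjTranspose_mul, rightGram_mul_conjTranspose, conjBy_mul hs, conjBy_mul hs,
        ← hN, ← hH]
    · rw [matrixPattern_perm_swap p q N π fun i j => ?_] at hij
      · rw [Matrix.smul_apply, conjBy, hS.conj_apply, Matrix.conjTranspose_apply, h3 _ _ hij,
          star_zero, mul_zero, zero_mul, smul_zero]
      · conv_lhs => rw [← hA]
        rw [norm_smul_conjBy_apply hS hε, Matrix.conjTranspose_apply, norm_star]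
  · have hd : ε • conjBy S Xᴴ - A = ε • conjBy S (X - A)ᴴ := by
      rw [Matrix.conjTranspose_sub, conjBy_sub, smul_sub, hA]
    rw [misfit_eq_trace, misfit_eq_trace, hd, Matrix.conjTranspose_smul, conjBy_conjTranspose,
      Matrix.conjTranspose_conjTranspose]
    simp only [Matrix.smul_mul, Matrix.mul_smul, smul_smul, star_trivial, hε, one_smul]
    conv_lhs => rw [hM]; arg 2; rw [hN]
    simp only [← conjBy_mul hs, trace_conjBy hs]
    exact add_comm _ _

theorem minimizer_transpose (D : SVD A) (p : ℝ≥0∞) (q : ℝ) (N : ℕ)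
    (hX : ∀ Y, D.IsMinimizer (matrixPattern p q N N A) Y ↔ Y = X) {ε : ℝ}
    (hε : ε * ε = 1) (hA : ε • Aᵀ = A) : ε • Xᵀ = X := by
  have ht : ∀ Y : Matrix (Fin m) (Fin m) ℂ, Yᵀᴴ = Yᴴᵀ := fun _ => rfl
  have hG : Aᴴ * A = (A * Aᴴ)ᵀ := by
    conv_lhs => rw [← hA]
    rw [Matrix.conjTranspose_smul, Matrix.smul_mul, Matrix.mul_smul,
      smul_smul, star_trivial, hε, one_smul, Matrix.transpose_mul, ht]
  have hH : A * Aᴴ = (Aᴴ * A)ᵀ := by rw [hG, Matrix.transpose_transpose]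
  have hM : D.rightGram = D.leftGramᵀ :=
    D.isGroupInverse_rightGram.unique (hG ▸ D.isGroupInverse_leftGram.transpose)
  have hN : D.leftGram = D.rightGramᵀ := by rw [hM, Matrix.transpose_transpose]
  refine D.fixed_of_preserves hX (fun X => ε • Xᵀ) (fun h => ?_) ?_
  · rw [isFeasible_iff] at h ⊢
    obtain ⟨h1, h2, h3⟩ := h
    refine ⟨?_, ?_, fun i j hij => ?_⟩
    · rw [Matrix.smul_mul]
      conv_rhs => rw [← h2]
      -- Transposing the projector reverses its factors; commutation restores the order of inverse
      -- and Gram matrix.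
      rw [Matrix.transpose_mul, ← D.isGroupInverse_leftGram.comm, Matrix.transpose_mul, ← hM, ← hG]
    · rw [Matrix.mul_smul]
      conv_rhs => rw [← h1]
      rw [Matrix.transpose_mul, ← D.isGroupInverse_rightGram.comm, Matrix.transpose_mul,
        ← hN, ← hH]
    · rw [matrixPattern_perm_swap p q N 1 fun i j => ?_] at hij
      · rw [Matrix.smul_apply, Matrix.transpose_apply]
        exact (congrArg _ (h3 _ _ hij)).trans (smul_zero _)
      · conv_lhs => rw [← hA]
        rw [Matrix.smul_apply, norm_smul, norm_eq_one_of_mul_self hε, one_mul]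
        rfl
  · have hd : ε • Xᵀ - A = ε • (X - A)ᵀ := by
      rw [Matrix.transpose_sub, smul_sub, hA]
    rw [misfit_eq_trace, misfit_eq_trace, hd, Matrix.conjTranspose_smul, ht]
    simp only [Matrix.smul_mul, Matrix.mul_smul, smul_smul, star_trivial, hε, one_smul]
    conv_lhs => rw [hM]; arg 2; rw [hN]
    simp only [← Matrix.transpose_mul, Matrix.trace_transpose, ← Matrix.mul_assoc]
    exact add_comm _ _

end SVD

/-! ### The matrix subspaces as fixed points -/

section FixedPoints

variable {m : ℕ} {S : Matrix (Fin m) (Fin m) ℂ} {π : Equiv.Perm (Fin m)} {s : Fin m → ℂ}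

theorem smul_conjBy_eq_iff (hS : IsMonomial S π s) (ε : ℝ) (A B : Matrix (Fin m) (Fin m) ℂ) :
    ε • conjBy S B = A ↔ A * S = ε • (S * B) := by
  constructor
  · rintro rfl
    rw [conjBy, Matrix.smul_mul, Matrix.mul_assoc, hS.conjTranspose_mul, Matrix.mul_one]
  · intro h
    rw [conjBy, ← Matrix.smul_mul, ← h, Matrix.mul_assoc, hS.mul_conjTranspose, Matrix.mul_one]

theorem sub_eq_zero_iff_conjBy (hS : IsMonomial S π s) (A B : Matrix (Fin m) (Fin m) ℂ) :
    A * S - S * B = 0 ↔ (1 : ℝ) • conjBy S B = A := by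
  rw [smul_conjBy_eq_iff hS, one_smul, sub_eq_zero]

theorem add_eq_zero_iff_conjBy (hS : IsMonomial S π s) (A B : Matrix (Fin m) (Fin m) ℂ) :
    A * S + S * B = 0 ↔ (-1 : ℝ) • conjBy S B = A := by
  rw [smul_conjBy_eq_iff hS, neg_one_smul, add_eq_zero_iff_eq_neg]

/-- The Hamiltonian conditions have the adjoint to the left of K, hence describe `Aᴴ` as a conjugate
of `A`; this brings them to the common form. -/
theorem smul_conjBy_conjTranspose_comm (ε : ℝ) (A : Matrix (Fin m) (Fin m) ℂ) :
    ε • conjBy S A = Aᴴ ↔ ε • conjBy S Aᴴ = A := by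
  rw [← Matrix.conjTranspose_inj, Matrix.conjTranspose_smul, conjBy_conjTranspose, star_trivial,
    Matrix.conjTranspose_conjTranspose]

theorem isHermitian_iff_conjBy (A : Matrix (Fin m) (Fin m) ℂ) :
    A.IsHermitian ↔ (1 : ℝ) • conjBy 1 Aᴴ = A := by
  rw [← sub_eq_zero_iff_conjBy (isMonomial_one m), Matrix.mul_one, Matrix.one_mul, sub_eq_zero]
  exact eq_comm

theorem isSkewHermitian_iff_conjBy (A : Matrix (Fin m) (Fin m) ℂ) :
    IsSkewHermitian A ↔ (-1 : ℝ) • conjBy 1 Aᴴ = A := by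
  rw [← add_eq_zero_iff_conjBy (isMonomial_one m), Matrix.mul_one, Matrix.one_mul]
  rfl

theorem isComplexSymmetric_iff_smul (A : Matrix (Fin m) (Fin m) ℂ) :
    IsComplexSymmetric A ↔ (1 : ℝ) • Aᵀ = A := by
  rw [IsComplexSymmetric, sub_eq_zero, one_smul, eq_comm]

theorem isSkewComplexSymmetric_iff_smul (A : Matrix (Fin m) (Fin m) ℂ) :
    IsSkewComplexSymmetric A ↔ (-1 : ℝ) • Aᵀ = A := by
  rw [IsSkewComplexSymmetric, add_eq_zero_iff_eq_neg, neg_one_smul, eq_comm]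

theorem isHamiltonian_iff_conjBy (hS : IsMonomial (skewK m) π s) (A : Matrix (Fin m) (Fin m) ℂ) :
    IsHamiltonian A ↔ (-1 : ℝ) • conjBy (skewK m) Aᴴ = A := by
  rw [← smul_conjBy_conjTranspose_comm, ← add_eq_zero_iff_conjBy hS, add_comm]
  rfl

theorem isSkewHamiltonian_iff_conjBy (hS : IsMonomial (skewK m) π s)
    (A : Matrix (Fin m) (Fin m) ℂ) :
    IsSkewHamiltonian A ↔ (1 : ℝ) • conjBy (skewK m) Aᴴ = A := by
  rw [← smul_conjBy_conjTranspose_comm, ← sub_eq_zero_iff_conjBy hS, ← neg_sub, neg_eq_zero]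
  rfl

end FixedPoints

end Sparsify

/-! ### The main theorem: each structure as a choice of symmetry and sign -/

theorem mainTheorem1 {m : ℕ} (A : Matrix (Fin m) (Fin m) ℂ) (D : Sparsify.SVD A)
    (p : ENNReal) (q : ℝ) (hq : q ∈ Set.Icc (0 : ℝ) 1) (Nrow Ncol : ℕ)
    (hN : (Nrow = Sparsify.standardNrow A ∧ Ncol = Sparsify.standardNcol A) ∨ Nrow = Ncol) :
    ∃ X : Matrix (Fin m) (Fin m) ℂ,
      (∀ Y, D.IsMinimizer (Sparsify.matrixPattern p q Nrow Ncol A) Y ↔ Y = X) ∧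
      (A.IsHermitian → X.IsHermitian) ∧
      (Sparsify.IsSkewHermitian A → Sparsify.IsSkewHermitian X) ∧
      (Sparsify.IsComplexSymmetric A → Sparsify.IsComplexSymmetric X) ∧
      (Sparsify.IsSkewComplexSymmetric A → Sparsify.IsSkewComplexSymmetric X) ∧
      (Even m → Sparsify.IsHamiltonian A → Sparsify.IsHamiltonian X) ∧
      (Even m → Sparsify.IsSkewHamiltonian A → Sparsify.IsSkewHamiltonian X) ∧
      (Sparsify.IsCirculant A → Sparsify.IsCirculant X) ∧
      (Sparsify.IsSkewCirculant A → Sparsify.IsSkewCirculant X) ∧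
      (Sparsify.IsCentrosymmetric A → Sparsify.IsCentrosymmetric X) ∧
      (Sparsify.IsSkewCentrosymmetric A → Sparsify.IsSkewCentrosymmetric X) ∧
      (Sparsify.IsPersymmetric A → Sparsify.IsPersymmetric X) ∧
      (Sparsify.IsSkewPersymmetric A → Sparsify.IsSkewPersymmetric X) := by
  -- For square `A` both options give equal counts, as the symmetries exchanging rows and columns
  -- require.
  obtain rfl : Nrow = Ncol := by
    rcases hN with ⟨rfl, rfl⟩ | h
    · rw [Sparsify.standardNrow, Sparsify.standardNcol, Sparsify.nullity_conjTranspose]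
    · exact h
  obtain ⟨X, hX⟩ := D.existsUnique_isMinimizer (Sparsify.matrixPattern p q Nrow Nrow A)
  have h1 : (1 : ℝ) * 1 = 1 := one_mul 1
  have h2 : (-1 : ℝ) * -1 = 1 := by norm_num
  have hI := Sparsify.isMonomial_one m
  have hJ := Sparsify.isMonomial_exchange m
  obtain ⟨_, _, hC⟩ := Sparsify.exists_isMonomial_cyclic m (ε := 1) (by simp)
  obtain ⟨_, _, hC'⟩ := Sparsify.exists_isMonomial_cyclic m (ε := -1) (by simp)
  refine ⟨X, hX, ?_, ?_, ?_, ?_, fun hm => ?_, fun hm => ?_, ?_, ?_, ?_, ?_, ?_, ?_⟩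
  · rw [Sparsify.isHermitian_iff_conjBy, Sparsify.isHermitian_iff_conjBy]
    exact D.minimizer_conj_conjTranspose hI p q Nrow hX h1
  · rw [Sparsify.isSkewHermitian_iff_conjBy, Sparsify.isSkewHermitian_iff_conjBy]
    exact D.minimizer_conj_conjTranspose hI p q Nrow hX h2
  · rw [Sparsify.isComplexSymmetric_iff_smul, Sparsify.isComplexSymmetric_iff_smul]
    exact D.minimizer_transpose p q Nrow hX h1
  · rw [Sparsify.isSkewComplexSymmetric_iff_smul, Sparsify.isSkewComplexSymmetric_iff_smul]
    exact D.minimizer_transpose p q Nrow hX h2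
  · obtain ⟨_, _, hK⟩ := Sparsify.exists_isMonomial_skewK hm
    rw [Sparsify.isHamiltonian_iff_conjBy hK, Sparsify.isHamiltonian_iff_conjBy hK]
    exact D.minimizer_conj_conjTranspose hK p q Nrow hX h2
  · obtain ⟨_, _, hK⟩ := Sparsify.exists_isMonomial_skewK hm
    rw [Sparsify.isSkewHamiltonian_iff_conjBy hK, Sparsify.isSkewHamiltonian_iff_conjBy hK]
    exact D.minimizer_conj_conjTranspose hK p q Nrow hX h1
  · exact fun h => (Sparsify.sub_eq_zero_iff_conjBy hC X X).2
      (D.minimizer_conj hC p q Nrow Nrow hX h1 ((Sparsify.sub_eq_zero_iff_conjBy hC A A).1 h))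
  · exact fun h => (Sparsify.sub_eq_zero_iff_conjBy hC' X X).2
      (D.minimizer_conj hC' p q Nrow Nrow hX h1 ((Sparsify.sub_eq_zero_iff_conjBy hC' A A).1 h))
  · exact fun h => (Sparsify.sub_eq_zero_iff_conjBy hJ X X).2
      (D.minimizer_conj hJ p q Nrow Nrow hX h1 ((Sparsify.sub_eq_zero_iff_conjBy hJ A A).1 h))
  · exact fun h => (Sparsify.add_eq_zero_iff_conjBy hJ X X).2
      (D.minimizer_conj hJ p q Nrow Nrow hX h2 ((Sparsify.add_eq_zero_iff_conjBy hJ A A).1 h))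
  · exact fun h => (Sparsify.sub_eq_zero_iff_conjBy hJ X Xᴴ).2
      (D.minimizer_conj_conjTranspose hJ p q Nrow hX h1
        ((Sparsify.sub_eq_zero_iff_conjBy hJ A Aᴴ).1 h))
  · exact fun h => (Sparsify.add_eq_zero_iff_conjBy hJ X Xᴴ).2
      (D.minimizer_conj_conjTranspose hJ p q Nrow hX h2
        ((Sparsify.add_eq_zero_iff_conjBy hJ A Aᴴ).1 h))
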